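/- Let $K$ be a field of arbitrary characteristic, let $V$ be a $K$-vector space of dimension $\ell$, and let $\Delta=(\alpha_1,\dots,\alpha_n)$ be a sequence of nonzero linear forms spanning the dual space $V^*$ (repeated or proportional forms are allowed). For $S\subseteq E=\{1,\dots,n\}$ let $r(S)=\dim_K\operatorname{span}\{\alpha_i:i\in S\}$, and let $$T(\Delta;x,y)=\sum_{S\subseteq E}(x-1)^{r(E)-r(S)}(y-1)^{|S|-r(S)}$$ be the Tutte polynomial of the matroid on $E$ realized by $\Delta$. Let $C(\Delta)$ be the $K$-subalgebra of the field of rational functions on $V$ (the fraction field of $\operatorname{Sym}(V^*)$) generated by the reciprocals $1/\alpha_1,\dots,1/\alpha_n$, and for $k\ge 0$ let $C(\Delta)_k$ be the $K$-span of the products $(\alpha_1^{d_1}\cdots\alpha_n^{d_n})^{-1}$ with $d_i \ge 0$ and $d_1+\cdots+d_n=k$. Then the subspaces $C(\Delta)_k$ are finite-dimensional, they make $C(\Delta)=\bigoplus_{k\ge 0}C(\Delta)_k$ a graded $K$-algebra, and its Hilbert series is $$\operatorname{Hilb}(C(\Delta),y):=\sum_{k\ge 0}\dim_K C(\Delta)_k\,y^k=\left(\frac{y}{1-y}\right)^{\ell}T(\Delta;1/y,0),$$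 an identity of formal Laurent series in $y$. -/

import Mathlib

open Module

noncomputable section

namespace LinForms

variable {K V : Type*} [Field K] [AddCommGroup V] [Module K V] {n : ℕ}

/-- The rank `r(S)` in the matroid `M(Δ)` on `{0, …, n-1}` realized by `Δ = (α₀, …, α_{n-1})`:
the dimension of the span of `{α i : i ∈ S}`. -/
def rank (α : Fin n → Dual K V) (S : Finset (Fin n)) : ℕ :=
  finrank K (Submodule.span K (α '' (S : Set (Fin n))))

/-- The Tutte polynomial `T(Δ; x, y)` of the matroid `M(Δ)`,
`∑_{S ⊆ E} (x - 1)^(r(E) - r(S)) (y - 1)^(|S| - r(S))`, with `x = X 0` and `y = X 1`.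
The subtractions never truncate, since `r(S) ≤ r(E)` and `r(S) ≤ |S|`. -/
def tuttePoly (α : Fin n → Dual K V) : MvPolynomial (Fin 2) ℤ :=
  ∑ S : Finset (Fin n),
    (MvPolynomial.X 0 - 1) ^ (rank α Finset.univ - rank α S) *
      (MvPolynomial.X 1 - 1) ^ (S.card - rank α S)

variable (K V) in
/-- The field of rational functions on `V`: the fraction field of `Sym(V*)`. -/
abbrev RatFunctions : Type _ :=
  FractionRing (SymmetricAlgebra K (Dual K V))

/-- A linear form seen as a rational function on `V`. -/
def toRat (φ : Dual K V) : RatFunctions K V :=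
  algebraMap (SymmetricAlgebra K (Dual K V)) (RatFunctions K V)
    (SymmetricAlgebra.ι K (Dual K V) φ)

variable [FiniteDimensional K V]

/-- `C(Δ)`: the `K`-algebra generated by the reciprocals `1 / α i`. -/
def recipAlgebra (α : Fin n → Dual K V) : Subalgebra K (RatFunctions K V) :=
  Algebra.adjoin K (Set.range fun i => (toRat (α i))⁻¹)

/-- The generator `1 / α i` as an element of `C(Δ)`. -/
def recip (α : Fin n → Dual K V) (i : Fin n) : recipAlgebra α :=
  ⟨(toRat (α i))⁻¹, Algebra.subset_adjoin (Set.mem_range_self i)⟩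

/-- The degree `k` piece of `C(Δ)`, when each `1 / α i` is given degree `1`: the span of the
products `∏ (1 / α i)^(d i)` with `∑ d i = k`. -/
def recipPiece (α : Fin n → Dual K V) (k : ℕ) : Submodule K (recipAlgebra α) :=
  Submodule.span K {f | ∃ d : Fin n → ℕ, ∑ i, d i = k ∧ f = ∏ i, recip α i ^ d i}

end LinForms

/-- The Hilbert series `∑ₖ (dim 𝒜ₖ) yᵏ` of a family of subspaces. -/
def hilbertSeries {K A : Type*} [Field K] [AddCommGroup A] [Module K A]
    (𝒜 : ℕ → Submodule K A) : PowerSeries ℚ :=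
  PowerSeries.mk fun k => (finrank K (𝒜 k) : ℚ)

/-- The variable `y`, in the field of formal Laurent series over `ℚ`. -/
def laurentY : LaurentSeries ℚ := ((PowerSeries.X : PowerSeries ℚ) : LaurentSeries ℚ)

end

/-!
The algebra `C(Δ)` has a basis of monomials in the reciprocals `1 / α i`, and the Hilbert series
counts them. Call a set `S` of indices nbc if no `α i` lies in the span of the `α s` with `s ∈ S` and
`i < s`; this says that `S` is independent and contains no broken circuit (`LinForms.IsNBC`). The
basis consists of the monomials `∏ (1 / α i) ^ d i` whose support `{i | d i ≠ 0}` is nbc.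

* They span (`LinForms.recipMonomial_mem_span_isNBC`). If `α i = ∑ c s • α s`, the sum being over
  indices `s > i` in the support of `d`, then `1 = ∑ c s • α s / α i`. Multiplied by the monomial of
  `d`, this writes it through monomials of the same degree in which one `1 / α s` has become
  `1 / α i`. The process terminates, as the weight `∑ d i * i` decreases.
* They are linearly independent (`LinForms.coeff_eq_zero_of_sum_prod_pow_eq_zero`). In a relation,
  take the terms with the highest pole along the last form `α`. If there is a pole, multiplying by
  that power of `α` and restricting to `α = 0` gives a relation between nbc monomials of the
  contraction; if there is none, the relation lives in the deletion. Conclude by induction on the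
  number of forms. With denominators cleared, this takes place in symmetric algebras only.

Straightening preserves the degree, so `C(Δ)` is graded. The monomials with support exactly `S` have
the generating function `t ^ #S` with `t = y / (1 - y)`, so the Hilbert series is the sum of `t ^ #S`
over the nbc sets `S`. By deletion and contraction (`LinForms.sum_isNBC_eq_sum_rank`) it equals
`∑ S, (-1) ^ (#S - r(S)) * t ^ r(S)`, which is `t ^ ℓ * T(Δ; 1 / y, 0)` because
`t * (1 / y - 1) = 1`.
-/

open Module

noncomputable section

namespace LinForms

/-! ### Sets without broken circuits and the rank generating function -/

section NBC

variable (K : Type*) {W : Type*} [Field K] [AddCommGroup W] [Module K W] {n : ℕ}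

/-- The independent sets containing no broken circuit (a circuit deprived of its smallest element)
of a family of vectors, expressed without circuits: no vector `α i` of the family, with `i` in `S`
or not, lies in the span of the members of `S` with an index larger than `i`. -/
def IsNBC (α : Fin n → W) (S : Finset (Fin n)) : Prop :=
  ∀ i, α i ∉ Submodule.span K (α '' {s | s ∈ S ∧ i < s})

variable {K}

lemma IsNBC.ne_zero {α : Fin n → W} {S : Finset (Fin n)} (h : IsNBC K α S) (i : Fin n) :
    α i ≠ 0 := fun h0 => h i (h0 ▸ Submodule.zero_mem _)

/-- Deletion: the nbc sets avoiding the last vector. -/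
lemma isNBC_map_castSucc (α : Fin (n + 1) → W) (S : Finset (Fin n)) :
    IsNBC K α (S.map Fin.castSuccEmb) ↔
      IsNBC K (fun i => α i.castSucc) S ∧ α (Fin.last n) ≠ 0 := by
  unfold IsNBC
  rw [Fin.forall_fin_succ']
  refine and_congr (forall_congr' fun i => not_congr ?_) (not_congr ?_)
  · have : α '' {s | s ∈ S.map Fin.castSuccEmb ∧ i.castSucc < s} =
        (fun i => α i.castSucc) '' {s | s ∈ S ∧ i < s} := by
      ext x
      simp only [Set.mem_image, Set.mem_ofPred_eq, Finset.mem_map]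
      constructor
      · rintro ⟨_, ⟨⟨s, hs, rfl⟩, hi⟩, rfl⟩
        exact ⟨s, ⟨hs, hi⟩, rfl⟩
      · rintro ⟨s, ⟨hs, hi⟩, rfl⟩
        exact ⟨s.castSucc, ⟨⟨s, hs, rfl⟩, hi⟩, rfl⟩
    rw [this]
  · have : {s | s ∈ S.map Fin.castSuccEmb ∧ Fin.last n < s} = ∅ := by
      ext s; simpa using fun _ _ _ => Fin.le_last s
    rw [this, Set.image_empty, Submodule.span_empty, Submodule.mem_bot]

lemma mkQ_mem_span_image_iff (a x : W) (T : Set W) :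
    (Submodule.span K {a}).mkQ x ∈ Submodule.span K ((Submodule.span K {a}).mkQ '' T) ↔
      x ∈ Submodule.span K (insert a T) := by
  rw [← Submodule.map_span, ← Submodule.mem_comap, Submodule.comap_map_mkQ, Submodule.span_insert]

/-- Contraction: the nbc sets containing the last vector. -/
lemma isNBC_insert_last (α : Fin (n + 1) → W) (S : Finset (Fin n)) :
    IsNBC K α (insert (Fin.last n) (S.map Fin.castSuccEmb)) ↔
      IsNBC K (fun i => (Submodule.span K {α (Fin.last n)}).mkQ (α i.castSucc)) S ∧
        α (Fin.last n) ≠ 0 := by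
  unfold IsNBC
  rw [Fin.forall_fin_succ']
  refine and_congr (forall_congr' fun i => not_congr ?_) (not_congr ?_)
  · have h1 : α '' {s | s ∈ insert (Fin.last n) (S.map Fin.castSuccEmb) ∧ i.castSucc < s} =
        insert (α (Fin.last n)) ((fun i => α i.castSucc) '' {s | s ∈ S ∧ i < s}) := by
      ext x
      simp only [Set.mem_image, Set.mem_ofPred_eq, Finset.mem_map, Finset.mem_insert,
        Set.mem_insert_iff]
      constructor
      · rintro ⟨_, ⟨rfl | ⟨s, hs, rfl⟩, hi⟩, rfl⟩
        · exact Or.inl rfl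
        · exact Or.inr ⟨s, ⟨hs, hi⟩, rfl⟩
      · rintro (rfl | ⟨s, ⟨hs, hi⟩, rfl⟩)
        · exact ⟨_, ⟨Or.inl rfl, Fin.castSucc_lt_last i⟩, rfl⟩
        · exact ⟨s.castSucc, ⟨Or.inr ⟨s, hs, rfl⟩, hi⟩, rfl⟩
    rw [h1, ← mkQ_mem_span_image_iff, Set.image_image]
  · have : {s | s ∈ insert (Fin.last n) (S.map Fin.castSuccEmb) ∧ Fin.last n < s} = ∅ := by
      ext s; simpa using fun _ => Fin.le_last s
    rw [this, Set.image_empty, Submodule.span_empty, Submodule.mem_bot]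

lemma finrank_image_le_card (α : Fin n → W) (S : Finset (Fin n)) :
    Set.finrank K (α '' (S : Set (Fin n))) ≤ S.card := by
  classical
  rw [← Finset.coe_image]
  exact (finrank_span_finset_le_card _).trans Finset.card_image_le

/-- Contracting a nonzero vector lowers the rank by one. -/
lemma finrank_insert_eq_mkQ_add_one {a : W} (ha : a ≠ 0) {T : Set W} (hT : T.Finite) :
    Set.finrank K (insert a T) =
      Set.finrank K ((Submodule.span K {a}).mkQ '' T) + 1 := by
  set L : Submodule K W := Submodule.span K {a}
  set U := Submodule.span K (insert a T)
  have : FiniteDimensional K U := FiniteDimensional.span_of_finite K (hT.insert a)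
  have hL : L ≤ U := Submodule.span_mono (by simp)
  have h := LinearMap.finrank_range_add_finrank_ker (L.mkQ.domRestrict U)
  have h1 : LinearMap.range (L.mkQ.domRestrict U) = Submodule.span K (L.mkQ '' T) := by
    rw [LinearMap.range_domRestrict, Submodule.map_span, Set.image_insert_eq]
    have : L.mkQ a = 0 := by
      rw [Submodule.mkQ_apply, Submodule.Quotient.mk_eq_zero]
      exact Submodule.mem_span_singleton_self a
    rw [this, Submodule.span_insert_zero]
  have h2 : finrank K (LinearMap.ker (L.mkQ.domRestrict U)) = 1 := by
    rw [LinearMap.ker_domRestrict, Submodule.ker_mkQ]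
    rw [← finrank_span_singleton (K := K) ha]
    exact (Submodule.comapSubtypeEquivOfLe hL).finrank_eq
  rw [h1, h2] at h
  exact h.symm

lemma sum_finset_fin_succ {R : Type*} [AddCommMonoid R] (f : Finset (Fin (n + 1)) → R) :
    ∑ S, f S = ∑ S : Finset (Fin n), f (S.map Fin.castSuccEmb) +
      ∑ S : Finset (Fin n), f (insert (Fin.last n) (S.map Fin.castSuccEmb)) := by
  classical
  have key (g : Finset (Fin (n + 1)) → R) :
      ∑ t ∈ ((Finset.univ : Finset (Fin n)).map Fin.castSuccEmb).powerset, g t =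
        ∑ S : Finset (Fin n), g (S.map Fin.castSuccEmb) := by
    symm
    refine Finset.sum_bij (fun S _ => S.map Fin.castSuccEmb) ?_ ?_ ?_ ?_
    · intro S _
      simp
    · intro S _ T _ h
      exact Finset.map_injective _ h
    · intro T hT
      rw [Finset.mem_powerset, Finset.subset_map_iff] at hT
      obtain ⟨u, -, rfl⟩ := hT
      exact ⟨u, Finset.mem_univ _, rfl⟩
    · intros; rfl
  rw [← Finset.powerset_univ, Fin.univ_castSuccEmb, Finset.cons_eq_insert,
    Finset.sum_powerset_insert (by simp), key, key]

open Classical in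
/-- Whitney's broken circuit theorem, in the form of an identity of polynomials in `t`. Both sides
satisfy the same deletion-contraction recursion with respect to the last vector. -/
theorem sum_isNBC_eq_sum_rank {R : Type*} [CommRing R] (t : R) :
    ∀ {n : ℕ} {W : Type*} [AddCommGroup W] [Module K W] (α : Fin n → W),
      ∑ S : Finset (Fin n), (if IsNBC K α S then t ^ S.card else 0) =
        ∑ S : Finset (Fin n), (-1) ^ (S.card - Set.finrank K (α '' (S : Set (Fin n)))) *
          t ^ Set.finrank K (α '' (S : Set (Fin n))) := by
  intro n
  induction n with
  | zero =>
    intro W _ _ α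
    have him (S : Finset (Fin 0)) : α '' (S : Set (Fin 0)) = ∅ := by
      simp [Finset.eq_empty_of_isEmpty S]
    have hnbc (S : Finset (Fin 0)) : IsNBC K α S := fun i => i.elim0
    simp only [him, hnbc, if_true, Set.finrank_empty]
    simp [Finset.eq_empty_of_isEmpty]
  | succ n ih =>
    intro W _ _ α
    have hcard (S : Finset (Fin n)) :
        (insert (Fin.last n) (S.map Fin.castSuccEmb)).card = S.card + 1 := by
      rw [Finset.card_insert_of_notMem (by simp), Finset.card_map]
    have him (S : Finset (Fin n)) : α '' ((S.map Fin.castSuccEmb : Finset (Fin (n + 1))) : Set _) =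
        (fun i => α i.castSucc) '' (S : Set (Fin n)) := by
      rw [Finset.coe_map, Set.image_image]; rfl
    rw [sum_finset_fin_succ, sum_finset_fin_succ]
    simp only [isNBC_map_castSucc, isNBC_insert_last, hcard, Finset.card_map, Finset.coe_insert,
      Set.image_insert_eq, him]
    -- If the last vector is zero there are no nbc sets, and adding it to `S` changes the sign of
    -- the term of `S` on the right.
    by_cases h0 : α (Fin.last n) = 0
    · simp only [h0, ne_eq, not_true_eq_false, and_false, if_false, Finset.sum_const_zero, add_zero]
      rw [← Finset.sum_add_distrib]
      symm
      refine Finset.sum_eq_zero fun S _ => ?_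
      have h1 : Set.finrank K (insert 0 ((fun i => α i.castSucc) '' (S : Set (Fin n)))) =
          Set.finrank K ((fun i => α i.castSucc) '' (S : Set (Fin n))) := by
        rw [Set.finrank, Set.finrank, Submodule.span_insert_zero]
      have h2 := finrank_image_le_card (K := K) (fun i => α i.castSucc) S
      rw [h1, Nat.sub_add_comm h2, pow_succ]
      ring
    · simp only [ne_eq, h0, not_false_eq_true, and_true]
      congr 1
      · exact ih _
      · have h1 (S : Finset (Fin n)) := finrank_insert_eq_mkQ_add_one (K := K) h0
          ((S.finite_toSet).image (fun i => α i.castSucc))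
        simp only [h1, Nat.add_sub_add_right, pow_succ t, Set.image_image]
        simp only [← mul_assoc, ← ite_zero_mul, ← Finset.sum_mul]
        rw [ih]

end NBC

/-! ### Products of linear forms in the symmetric algebra -/

section Independence

variable {K : Type*} [Field K]

lemma symmetricAlgebra_ι_ne_zero {W : Type*} [AddCommGroup W] [Module K W] {w : W} (hw : w ≠ 0) :
    SymmetricAlgebra.ι K W w ≠ 0 := by
  intro h
  refine hw ((Module.forall_dual_apply_eq_zero_iff K w).1 fun f => ?_)
  simpa using congrArg (SymmetricAlgebra.lift f) h

/-- In a domain, the lowest coefficient of a vanishing polynomial in `x` is divisible by `x`, and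
vanishes if it is also the highest one. -/
lemma lowest_coeff_of_sum_pow_mul_eq_zero {R : Type*} [CommRing R] [IsDomain R] {x : R}
    (hx : x ≠ 0) {N : ℕ} (Q : Fin (N + 1) → R) (hQ : ∑ b : Fin (N + 1), x ^ (b : ℕ) * Q b = 0)
    (a : Fin (N + 1)) (ha : ∀ b < a, Q b = 0) :
    x ∣ Q a ∧ (a = Fin.last N → Q a = 0) := by
  classical
  have h1 : x ^ (a : ℕ) * Q a + ∑ b ∈ Finset.univ.erase a, x ^ (b : ℕ) * Q b = 0 := by
    rw [Finset.add_sum_erase _ (fun b : Fin (N + 1) => x ^ (b : ℕ) * Q b)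
      (Finset.mem_univ a), hQ]
  constructor
  · have h2 : x ^ ((a : ℕ) + 1) ∣ ∑ b ∈ Finset.univ.erase a, x ^ (b : ℕ) * Q b := by
      refine Finset.dvd_sum fun b hb => ?_
      rcases lt_or_gt_of_ne (Finset.ne_of_mem_erase hb) with h | h
      · simp [ha b h]
      · exact Dvd.dvd.mul_right (pow_dvd_pow x h) _
    have h3 : x ^ ((a : ℕ) + 1) ∣ x ^ (a : ℕ) * Q a := by
      rw [eq_neg_of_add_eq_zero_left h1]
      exact (dvd_neg).2 h2
    rw [pow_succ] at h3
    exact (mul_dvd_mul_iff_left (pow_ne_zero _ hx)).1 h3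
  · rintro rfl
    rw [Finset.sum_eq_zero, add_zero] at h1
    · exact (mul_eq_zero.1 h1).resolve_left (pow_ne_zero _ hx)
    · intro b hb
      rw [ha b (lt_of_le_of_ne (Fin.le_last b) (Finset.ne_of_mem_erase hb)), mul_zero]

/-- Linear independence of the reciprocals of the monomials with nbc support, with denominators
cleared: the factor `α i ^ e i` stands for `α i ^ (-(N - e i))`, up to the common factor
`∏ i, α i ^ N`. The proof looks at the lowest power of the last vector that occurs, that is, at the
highest pole along it: if this is an actual pole, then the leading coefficient is a relation for the
contracted family, and otherwise it is one for the family without its last vector. -/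
lemma coeff_eq_zero_of_sum_prod_pow_eq_zero (N : ℕ) :
    ∀ {n : ℕ} {W : Type*} [AddCommGroup W] [Module K W] (α : Fin n → W)
      (c : (Fin n → Fin (N + 1)) → K),
      (∀ e, c e ≠ 0 → IsNBC K α {i | e i ≠ Fin.last N}) →
      ∑ e, c e • ∏ i, SymmetricAlgebra.ι K W (α i) ^ (e i : ℕ) = 0 → ∀ e, c e = 0 := by
  intro n
  induction n with
  | zero =>
    intro W _ _ α c _ h e
    rw [Fintype.sum_unique] at h
    rw [Finset.univ_eq_empty, Finset.prod_empty] at h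
    rw [Subsingleton.elim e _]
    exact (smul_eq_zero.1 h).resolve_right one_ne_zero
  | succ n ih =>
    intro W _ _ α c hc h
    by_contra! hne
    obtain ⟨e₀, he₀⟩ := hne
    have hlast : α (Fin.last n) ≠ 0 := (hc e₀ he₀).ne_zero _
    set x := SymmetricAlgebra.ι K W (α (Fin.last n)) with hx
    set Q : Fin (N + 1) → SymmetricAlgebra K W := fun a => ∑ e : Fin n → Fin (N + 1),
      c (Fin.snoc e a) • ∏ i, SymmetricAlgebra.ι K W (α i.castSucc) ^ (e i : ℕ) with hQ
    have hsum : ∑ b : Fin (N + 1), x ^ (b : ℕ) * Q b = 0 := by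
      rw [← h, ← (Fin.snocEquiv fun _ => Fin (N + 1)).sum_comp, Fintype.sum_prod_type]
      refine Finset.sum_congr rfl fun b _ => ?_
      rw [hQ, Finset.mul_sum]
      refine Finset.sum_congr rfl fun e _ => ?_
      rw [Fin.prod_univ_castSucc]
      simp [Fin.snocEquiv, mul_comm, hx]
    -- Induction on the exponent `a` of the last vector; `Q a` is its coefficient.
    have hall : ∀ a : Fin (N + 1), ∀ e : Fin n → Fin (N + 1), c (Fin.snoc e a) = 0 := by
      intro a
      induction a using WellFoundedLT.induction with
      | ind a iha =>
        obtain ⟨hdvd, htop⟩ := lowest_coeff_of_sum_pow_mul_eq_zero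
          (symmetricAlgebra_ι_ne_zero hlast) Q hsum a (fun b hb => by simp [hQ, iha b hb])
        -- Exponent `N` means that the last vector is absent from the reciprocal monomial.
        by_cases ha : a = Fin.last N
        · refine ih (fun i => α i.castSucc) (fun e => c (Fin.snoc e a)) ?_ (htop ha)
          intro e he
          have := hc _ he
          have hset : ({i | (Fin.snoc e a : Fin (n + 1) → Fin (N + 1)) i ≠ Fin.last N} :
              Finset (Fin (n + 1))) =
              ({i | e i ≠ Fin.last N} : Finset (Fin n)).map Fin.castSuccEmb := by
            ext i
            induction i using Fin.lastCases <;> simp [ha]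
          rw [hset, isNBC_map_castSucc] at this
          exact this.1
        · set q := (Submodule.span K {α (Fin.last n)}).mkQ
          let φ := SymmetricAlgebra.lift (SymmetricAlgebra.ι K _ ∘ₗ q)
          have hφ : φ (Q a) = 0 := by
            obtain ⟨y, hy⟩ := hdvd
            have hq : q (α (Fin.last n)) = 0 := by
              simp [q]
            rw [hy, map_mul]
            simp [φ, hq]
          refine ih (fun i => q (α i.castSucc)) (fun e => c (Fin.snoc e a)) ?_ ?_
          · intro e he
            have := hc _ he
            have hset : ({i | (Fin.snoc e a : Fin (n + 1) → Fin (N + 1)) i ≠ Fin.last N} :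
                Finset (Fin (n + 1))) = insert (Fin.last n)
                (({i | e i ≠ Fin.last N} : Finset (Fin n)).map Fin.castSuccEmb) := by
              ext i
              induction i using Fin.lastCases <;> simp [ha]
            rw [hset, isNBC_insert_last] at this
            exact this.1
          · rw [← hφ, hQ]
            simp [φ, map_sum, map_prod]
    apply he₀
    rw [← Fin.snoc_init_self e₀]
    exact hall _ _

end Independence

/-! ### Linear independence of reciprocal monomials -/

section Monomials

variable {K V : Type*} [Field K] [AddCommGroup V] [Module K V] {n : ℕ}

/-- The reciprocal `(∏ α i ^ d i)⁻¹` of a monomial in the forms `α i`, as a rational function. -/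
def recipMonomial (α : Fin n → Dual K V) (d : Fin n →₀ ℕ) : RatFunctions K V :=
  ∏ i, (toRat (α i))⁻¹ ^ d i

lemma toRat_ne_zero {φ : Dual K V} (hφ : φ ≠ 0) : toRat φ ≠ 0 := by
  rw [toRat, Ne, FaithfulSMul.algebraMap_eq_zero_iff]
  exact symmetricAlgebra_ι_ne_zero hφ

/-- Multiplied by `∏ i, α i ^ N` with `N` large, a linear relation between reciprocal monomials
becomes one between products of the forms `α i` in `Sym(V*)`. -/
lemma linearIndepOn_recipMonomial (α : Fin n → Dual K V) (hne : ∀ i, α i ≠ 0) :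
    LinearIndepOn K (recipMonomial α) {d | IsNBC K α d.support} := by
  classical
  rw [LinearIndepOn, linearIndependent_iff']
  intro s g hg d₀ hd₀
  set N := s.sup fun d => Finset.univ.sup fun i => d.1 i with hN
  have hle (d : {d : Fin n →₀ ℕ | IsNBC K α d.support}) (hd : d ∈ s) (i : Fin n) : d.1 i ≤ N :=
    (Finset.le_sup (f := fun i => d.1 i) (Finset.mem_univ i)).trans
      (Finset.le_sup (f := fun d : {d : Fin n →₀ ℕ | IsNBC K α d.support} =>
        Finset.univ.sup fun i => d.1 i) hd)
  let E (d : {d : Fin n →₀ ℕ | IsNBC K α d.support}) : Fin n → Fin (N + 1) :=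
    fun i => ⟨N - d.1 i, by omega⟩
  have hinj : Set.InjOn E s := by
    intro d hd d' hd' h
    ext i
    have := congrArg Fin.val (congrFun h i)
    have h1 := hle d hd i
    have h2 := hle d' hd' i
    simp only [E] at this
    omega
  let c (e : Fin n → Fin (N + 1)) : K := ∑ d ∈ s with E d = e, g d
  have hcE (d) (hd : d ∈ s) : c (E d) = g d := by
    refine Finset.sum_eq_single_of_mem d (Finset.mem_filter.2 ⟨hd, rfl⟩) ?_
    intro d' hd' hne'
    rw [Finset.mem_filter] at hd'
    exact absurd (hinj hd'.1 hd hd'.2) hne'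
  rw [← hcE d₀ hd₀]
  refine coeff_eq_zero_of_sum_prod_pow_eq_zero N α c ?_ ?_ _
  · intro e he
    obtain ⟨d, hd, -⟩ := Finset.exists_ne_zero_of_sum_ne_zero he
    rw [Finset.mem_filter] at hd
    refine (congrArg (IsNBC K α) ?_).mpr d.2
    ext i
    have := hle d hd.1 i
    simp only [← hd.2, E, Finset.mem_filter, Finset.mem_univ, true_and, Finsupp.mem_support_iff,
      Ne, Fin.ext_iff, Fin.val_last]
    omega
  · apply FaithfulSMul.algebraMap_injective (SymmetricAlgebra K (Dual K V)) (RatFunctions K V)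
    have hfib : ∑ e, c e • ∏ i, SymmetricAlgebra.ι K (Dual K V) (α i) ^ (e i : ℕ) =
        ∑ d ∈ s, g d • ∏ i, SymmetricAlgebra.ι K (Dual K V) (α i) ^ (E d i : ℕ) := by
      rw [← Finset.sum_fiberwise s E]
      refine Finset.sum_congr rfl fun e _ => ?_
      rw [Finset.sum_smul]
      refine Finset.sum_congr rfl fun d hd => ?_
      rw [(Finset.mem_filter.1 hd).2]
    have hterm (d) (hd : d ∈ s) :
        algebraMap (SymmetricAlgebra K (Dual K V)) (RatFunctions K V)
          (g d • ∏ i, SymmetricAlgebra.ι K (Dual K V) (α i) ^ (E d i : ℕ)) =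
        (∏ i, toRat (α i) ^ N) * (g d • recipMonomial α d.1) := by
      rw [mul_smul_comm, recipMonomial, ← Finset.prod_mul_distrib, ← IsScalarTower.coe_toAlgHom' K,
        map_smul, map_prod]
      congr 1
      refine Finset.prod_congr rfl fun i _ => ?_
      rw [map_pow, IsScalarTower.coe_toAlgHom', ← toRat]
      exact (pow_sub₀ (toRat (α i)) (toRat_ne_zero (hne i)) (hle d hd i)).trans
        (congrArg _ (inv_pow (toRat (α i)) _).symm)
    rw [hfib, map_sum, map_zero, Finset.sum_congr rfl hterm, ← Finset.mul_sum, hg, mul_zero]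

end Monomials

/-! ### Straightening of reciprocal monomials -/

section Spanning

variable {K V : Type*} [Field K] [AddCommGroup V] [Module K V] {n : ℕ}

variable (K V) in
/-- The embedding of the linear forms into the rational functions, as a linear map. -/
def toRatLinear : Dual K V →ₗ[K] RatFunctions K V :=
  (IsScalarTower.toAlgHom K (SymmetricAlgebra K (Dual K V)) (RatFunctions K V)).toLinearMap ∘ₗ
    SymmetricAlgebra.ι K (Dual K V)

lemma recipMonomial_add (α : Fin n → Dual K V) (d e : Fin n →₀ ℕ) :
    recipMonomial α (d + e) = recipMonomial α d * recipMonomial α e := by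
  simp [recipMonomial, pow_add, Finset.prod_mul_distrib]

lemma recipMonomial_single (α : Fin n → Dual K V) (i : Fin n) :
    recipMonomial α (Finsupp.single i 1) = (toRat (α i))⁻¹ := by
  classical
  simp [recipMonomial, Finsupp.single_apply, pow_ite]

/-- Straightening: if the support of `d` is not nbc, then some `α i` is a linear combination of the
`α s` with `i < s` and `d s ≠ 0`. Dividing this relation by `α i` and multiplying it by the
reciprocal monomial of `d` expresses the latter through reciprocal monomials in which a factor
`1 / α s` has been traded for `1 / α i`. This lowers the weight `∑ i, d i * i`. -/
theorem recipMonomial_mem_span_isNBC (α : Fin n → Dual K V) (hne : ∀ i, α i ≠ 0)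
    (d : Fin n →₀ ℕ) :
    recipMonomial α d ∈ Submodule.span K (recipMonomial α ''
      {d' | IsNBC K α d'.support ∧ d'.degree = d.degree}) := by
  induction hw : ∑ i, d i * (i : ℕ) using Nat.strong_induction_on generalizing d with
  | _ w ih =>
  by_cases hd : IsNBC K α d.support
  · exact Submodule.subset_span ⟨d, ⟨hd, rfl⟩, rfl⟩
  · simp only [IsNBC, not_forall, not_not] at hd
    obtain ⟨i, hi⟩ := hd
    set U := Submodule.span K (recipMonomial α ''
      {d' | IsNBC K α d'.support ∧ d'.degree = d.degree})
    let f : Dual K V →ₗ[K] RatFunctions K V :=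
      LinearMap.mulLeft K (recipMonomial α d * (toRat (α i))⁻¹) ∘ₗ toRatLinear K V
    have hf (φ : Dual K V) : f φ = recipMonomial α d * (toRat (α i))⁻¹ * toRat φ := rfl
    have hle : Submodule.span K (α '' {s | s ∈ d.support ∧ i < s}) ≤ U.comap f := by
      rw [Submodule.span_le]
      rintro _ ⟨s, ⟨hs, his⟩, rfl⟩
      obtain ⟨e, rfl⟩ : ∃ e, d = e + Finsupp.single s 1 := by
        refine ⟨d - Finsupp.single s 1, (tsub_add_cancel_of_le ?_).symm⟩
        rw [Finsupp.single_le_iff]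
        exact Nat.one_le_iff_ne_zero.2 (Finsupp.mem_support_iff.1 hs)
      have hfs : f (α s) = recipMonomial α (e + Finsupp.single i 1) := by
        rw [hf, recipMonomial_add, recipMonomial_add, recipMonomial_single, recipMonomial_single]
        field_simp [toRat_ne_zero (hne s)]
      have hdeg : (e + Finsupp.single i 1).degree = (e + Finsupp.single s 1).degree := by
        simp
      have hsum (j : Fin n) : ∑ k : Fin n, (e + Finsupp.single j 1 : Fin n →₀ ℕ) k * (k : ℕ) =
          ∑ k : Fin n, e k * (k : ℕ) + j := by
        classical
        simp [add_mul, Finset.sum_add_distrib, Finsupp.single_apply]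
      have := ih _ (by rw [← hw, hsum, hsum]; exact Nat.add_lt_add_left his _)
        (e + Finsupp.single i 1) rfl
      rw [hdeg] at this
      rwa [SetLike.mem_coe, Submodule.mem_comap, hfs]
    have hfi : f (α i) = recipMonomial α d :=
      inv_mul_cancel_right₀ (b := toRat (α i)) (toRat_ne_zero (hne i)) _
    exact hfi ▸ hle hi

end Spanning

/-! ### The grading of the algebra of reciprocals -/

section Grading

variable {K V : Type*} [Field K] [AddCommGroup V] [Module K V] [FiniteDimensional K V] {n : ℕ}

/-- The reciprocal monomial `∏ (1 / α i) ^ d i` as an element of `C(Δ)`. -/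
def recipProd (α : Fin n → Dual K V) (d : Fin n →₀ ℕ) : recipAlgebra α :=
  ∏ i, recip α i ^ d i

lemma coe_recipProd (α : Fin n → Dual K V) (d : Fin n →₀ ℕ) :
    (recipProd α d : RatFunctions K V) = recipMonomial α d := by
  simp [recipProd, recipMonomial, recip]

lemma recipProd_add (α : Fin n → Dual K V) (d e : Fin n →₀ ℕ) :
    recipProd α (d + e) = recipProd α d * recipProd α e :=
  Subtype.ext <| by simp [coe_recipProd, recipMonomial_add]

lemma recipProd_zero (α : Fin n → Dual K V) : recipProd α 0 = 1 := by
  simp [recipProd]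

lemma linearIndepOn_recipProd (α : Fin n → Dual K V) (hne : ∀ i, α i ≠ 0) :
    LinearIndepOn K (recipProd α) {d | IsNBC K α d.support} := by
  refine LinearIndependent.of_comp (recipAlgebra α).val.toLinearMap ?_
  have h : (recipAlgebra α).val.toLinearMap ∘ recipProd α = recipMonomial α :=
    funext (coe_recipProd α)
  have := linearIndepOn_recipMonomial α hne
  rw [← h] at this
  exact this

lemma recipPiece_eq_span (α : Fin n → Dual K V) (k : ℕ) :
    recipPiece α k = Submodule.span K (recipProd α '' {d | d.degree = k}) := by
  rw [recipPiece]
  congr 1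
  ext f
  constructor
  · rintro ⟨d, hd, rfl⟩
    exact ⟨Finsupp.equivFunOnFinite.symm d, by simpa [Finsupp.degree_eq_sum] using hd,
      by simp [recipProd]⟩
  · rintro ⟨d, hd, rfl⟩
    exact ⟨d, by simpa [Finsupp.degree_eq_sum] using hd, rfl⟩

/-- With `linearIndepOn_recipProd`: the reciprocal monomials of degree `k` with nbc support form a
basis of the degree `k` piece. -/
lemma recipPiece_eq_span_isNBC (α : Fin n → Dual K V) (hne : ∀ i, α i ≠ 0) (k : ℕ) :
    recipPiece α k =
      Submodule.span K (recipProd α '' {d | IsNBC K α d.support ∧ d.degree = k}) := by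
  rw [recipPiece_eq_span]
  refine le_antisymm (Submodule.span_le.2 ?_)
    (Submodule.span_mono (Set.image_mono fun d hd => hd.2))
  rintro _ ⟨d, rfl, rfl⟩
  have h := recipMonomial_mem_span_isNBC α hne d
  have himg : recipMonomial α '' {d' | IsNBC K α d'.support ∧ d'.degree = d.degree} =
      (recipAlgebra α).val.toLinearMap ''
        (recipProd α '' {d' | IsNBC K α d'.support ∧ d'.degree = d.degree}) := by
    rw [Set.image_image]
    exact Set.image_congr fun e _ => (coe_recipProd α e).symm
  rw [himg, ← Submodule.map_span, ← coe_recipProd] at h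
  obtain ⟨x, hx, hxd⟩ := h
  rwa [← Subtype.ext hxd]

lemma recipPiece_gradedMonoid (α : Fin n → Dual K V) :
    SetLike.GradedMonoid (recipPiece α) where
  one_mem := by
    rw [recipPiece_eq_span]
    exact Submodule.subset_span ⟨0, by simp, recipProd_zero α⟩
  mul_mem := by
    intro i j f g hf hg
    rw [recipPiece_eq_span] at *
    have h := Submodule.mul_mem_mul hf hg
    rw [Submodule.span_mul_span] at h
    refine Submodule.span_mono ?_ h
    rintro _ ⟨_, ⟨d, rfl, rfl⟩, _, ⟨e, rfl, rfl⟩, rfl⟩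
    exact ⟨d + e, by simp, recipProd_add α d e⟩

lemma span_range_recipProd (α : Fin n → Dual K V) :
    Submodule.span K (Set.range (recipProd α)) = ⊤ := by
  rw [eq_top_iff]
  rintro ⟨x, hx⟩ -
  induction hx using Algebra.adjoin_induction with
  | mem x hx =>
    obtain ⟨i, rfl⟩ := hx
    exact Submodule.subset_span ⟨Finsupp.single i 1,
      Subtype.ext ((coe_recipProd _ _).trans (recipMonomial_single α i))⟩
  | algebraMap r =>
    have h : (1 : recipAlgebra α) ∈ Submodule.span K (Set.range (recipProd α)) :=
      Submodule.subset_span ⟨0, recipProd_zero α⟩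
    convert Submodule.smul_mem _ r h using 1
    exact Subtype.ext (Algebra.algebraMap_eq_smul_one r)
  | add x y hx hy ihx ihy => exact Submodule.add_mem _ ihx ihy
  | mul x y hx hy ihx ihy =>
    have h := Submodule.mul_mem_mul ihx ihy
    rw [Submodule.span_mul_span] at h
    refine Submodule.span_mono ?_ h
    rintro _ ⟨_, ⟨d, rfl⟩, _, ⟨e, rfl⟩, rfl⟩
    exact ⟨d + e, recipProd_add α d e⟩

lemma isInternal_recipPiece (α : Fin n → Dual K V) (hne : ∀ i, α i ≠ 0) :
    DirectSum.IsInternal (recipPiece α) := by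
  rw [DirectSum.isInternal_submodule_iff_iSupIndep_and_iSup_eq_top]
  constructor
  · intro k
    have hdisj := (linearIndepOn_recipProd α hne).disjoint_span_image
      (s := {d | d.1.degree = k}) (t := {d | d.1.degree ≠ k})
      (Set.disjoint_left.2 fun d h1 h2 => h2 h1)
    refine hdisj.mono ?_ (iSup₂_le fun j hj => ?_)
    · rw [recipPiece_eq_span_isNBC α hne]
      refine Submodule.span_mono ?_
      rintro _ ⟨d, ⟨h1, h2⟩, rfl⟩
      exact ⟨⟨d, h1⟩, h2, rfl⟩
    · rw [recipPiece_eq_span_isNBC α hne]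
      refine Submodule.span_mono ?_
      rintro _ ⟨d, ⟨h1, h2⟩, rfl⟩
      exact ⟨⟨d, h1⟩, fun h => hj (h2 ▸ h), rfl⟩
  · rw [eq_top_iff, ← span_range_recipProd, Submodule.span_le]
    rintro _ ⟨d, rfl⟩
    refine Submodule.mem_iSup_of_mem d.degree ?_
    rw [recipPiece_eq_span]
    exact Submodule.subset_span ⟨d, rfl, rfl⟩

open Classical in
lemma recipPiece_eq_span_finset (α : Fin n → Dual K V) (hne : ∀ i, α i ≠ 0) (k : ℕ) :
    recipPiece α k = Submodule.span K (recipProd α ''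
      ((Finset.univ.finsuppAntidiag k).filter fun d => IsNBC K α d.support :
        Finset (Fin n →₀ ℕ))) := by
  rw [recipPiece_eq_span_isNBC α hne]
  congr 2
  ext d
  simp [Finset.mem_finsuppAntidiag, Finsupp.degree_eq_sum, and_comm]

open Classical in
lemma finrank_recipPiece (α : Fin n → Dual K V) (hne : ∀ i, α i ≠ 0) (k : ℕ) :
    finrank K (recipPiece α k) =
      ((Finset.univ.finsuppAntidiag k).filter fun d => IsNBC K α d.support).card := by
  rw [recipPiece_eq_span_finset α hne]
  set F := (Finset.univ.finsuppAntidiag k).filter fun d : Fin n →₀ ℕ => IsNBC K α d.support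
  have hF : LinearIndepOn K (recipProd α) (F : Set (Fin n →₀ ℕ)) :=
    (linearIndepOn_recipProd α hne).mono fun d hd => (Finset.mem_filter.1 hd).2
  rw [Set.image_eq_range]
  exact (finrank_span_eq_card hF).trans (Fintype.card_coe F)

lemma finite_recipPiece (α : Fin n → Dual K V) (hne : ∀ i, α i ≠ 0) (k : ℕ) :
    Module.Finite K (recipPiece α k) := by
  classical
  rw [recipPiece_eq_span_finset α hne]
  exact FiniteDimensional.span_of_finite K ((Finset.finite_toSet _).image _)

end Grading

/-! ### The Hilbert series as a sum over nbc sets -/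

section Hilbert

open PowerSeries

variable {K V : Type*} [Field K] [AddCommGroup V] [Module K V] [FiniteDimensional K V] {n : ℕ}

/-- The power series `X + X² + X³ + ⋯ = X / (1 - X)`. -/
def geomTail : PowerSeries ℚ := PowerSeries.mk fun d => if d = 0 then 0 else 1

lemma one_sub_X_mul_geomTail : (1 - X) * geomTail = (X : PowerSeries ℚ) := by
  ext d
  rw [sub_mul, one_mul, map_sub]
  rcases d with _ | _ | d <;> simp [geomTail, coeff_succ_X_mul, coeff_X]

open Classical in
/-- The exponent vectors with support `S` have generating function `(X / (1 - X)) ^ #S`. -/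
lemma coeff_geomTail_pow_card (S : Finset (Fin n)) (k : ℕ) :
    coeff k (geomTail ^ S.card) =
      (((Finset.univ.finsuppAntidiag k).filter fun d : Fin n →₀ ℕ => d.support = S).card : ℚ) := by
  have h : geomTail ^ S.card = ∏ i : Fin n, if i ∈ S then geomTail else 1 := by
    rw [Finset.prod_ite_mem, Finset.univ_inter, Finset.prod_const]
  rw [h, coeff_prod, Finset.card_filter, Nat.cast_sum]
  refine Finset.sum_congr rfl fun d _ => ?_
  have h1 (i : Fin n) : coeff (d i) (if i ∈ S then geomTail else 1) =
      if (i ∈ d.support ↔ i ∈ S) then (1 : ℚ) else 0 := by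
    by_cases hi : i ∈ S <;> by_cases hd : d i = 0 <;> simp [hi, hd, geomTail, coeff_one]
  rw [Finset.prod_congr rfl fun i _ => h1 i, Finset.prod_ite_zero]
  simp [Finset.ext_iff]

open Classical in
lemma hilbertSeries_recipPiece (α : Fin n → Dual K V) (hne : ∀ i, α i ≠ 0) :
    hilbertSeries (recipPiece α) =
      ∑ S : Finset (Fin n), if IsNBC K α S then geomTail ^ S.card else 0 := by
  ext k
  rw [hilbertSeries, coeff_mk, finrank_recipPiece α hne, ← Finset.sum_filter, map_sum,
    Finset.card_eq_sum_card_fiberwise (f := Finsupp.support)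
      (t := Finset.univ.filter fun S => IsNBC K α S)
      (fun d hd => by simpa using (Finset.mem_filter.1 hd).2)]
  rw [Nat.cast_sum]
  refine Finset.sum_congr rfl fun S hS => ?_
  rw [coeff_geomTail_pow_card, Finset.filter_filter]
  congr 2
  refine Finset.filter_congr fun d _ => and_iff_right_of_imp ?_
  rintro rfl
  exact (Finset.mem_filter.1 hS).2

end Hilbert

/-! ### Bounds on the rank -/

section Rank

variable {K V : Type*} [Field K] [AddCommGroup V] [Module K V] {n : ℕ}

lemma rank_univ {α : Fin n → Dual K V} (hspan : Submodule.span K (Set.range α) = ⊤) :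
    rank α Finset.univ = finrank K V := by
  rw [rank, Finset.coe_univ, Set.image_univ, hspan, finrank_top, Subspace.dual_finrank_eq]

lemma rank_le [FiniteDimensional K V] (α : Fin n → Dual K V) (S : Finset (Fin n)) :
    rank α S ≤ finrank K V := by
  rw [rank, ← Subspace.dual_finrank_eq (K := K)]
  exact Submodule.finrank_le _

end Rank

end LinForms

end

theorem mainTheorem2 {K V : Type*} [Field K] [AddCommGroup V] [Module K V]
    [FiniteDimensional K V] (ℓ n : ℕ) (hℓ : Module.finrank K V = ℓ)
    (α : Fin n → Module.Dual K V)
    (hspan : Submodule.span K (Set.range α) = ⊤) (hne : ∀ i, α i ≠ 0) :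
    Nonempty (GradedAlgebra (LinForms.recipPiece α)) ∧
    (∀ k, Module.Finite K (LinForms.recipPiece α k)) ∧
    ((hilbertSeries (LinForms.recipPiece α) : PowerSeries ℚ) : LaurentSeries ℚ) =
      (laurentY / (1 - laurentY)) ^ ℓ *
        MvPolynomial.aeval ![1 / laurentY, 0] (LinForms.tuttePoly α) := by
  refine ⟨⟨?_⟩, LinForms.finite_recipPiece α hne, ?_⟩
  · letI := LinForms.recipPiece_gradedMonoid α
    letI := (LinForms.isInternal_recipPiece α hne).chooseDecomposition
    exact { (inferInstance : SetLike.GradedMonoid (LinForms.recipPiece α)),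
      (inferInstance : DirectSum.Decomposition (LinForms.recipPiece α)) with }
  · have hX : laurentY ≠ 0 := by
      rw [laurentY, Ne, ← PowerSeries.coe_zero, HahnSeries.ofPowerSeries_injective.eq_iff]
      exact PowerSeries.X_ne_zero
    have hX1 : 1 - laurentY ≠ 0 := by
      rw [laurentY, ← PowerSeries.coe_one, ← PowerSeries.coe_sub, Ne, ← PowerSeries.coe_zero,
        HahnSeries.ofPowerSeries_injective.eq_iff]
      intro h
      simpa using congrArg PowerSeries.constantCoeff h
    set t : LaurentSeries ℚ := laurentY / (1 - laurentY) with ht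
    have hgeom : ((LinForms.geomTail : PowerSeries ℚ) : LaurentSeries ℚ) = t := by
      rw [ht, eq_div_iff hX1, mul_comm, laurentY, ← PowerSeries.coe_one, ← PowerSeries.coe_sub,
        ← PowerSeries.coe_mul, LinForms.one_sub_X_mul_geomTail]
    have htu : t * (1 / laurentY - 1) = 1 := by
      rw [ht]; field_simp
    rw [LinForms.hilbertSeries_recipPiece α hne, LinForms.sum_isNBC_eq_sum_rank,
      LinForms.tuttePoly, map_sum, map_sum, Finset.mul_sum]
    refine Finset.sum_congr rfl fun S _ => ?_
    change _ = t ^ ℓ * _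
    have hr : LinForms.rank α S ≤ ℓ := hℓ ▸ LinForms.rank_le α S
    rw [LinForms.rank_univ hspan, hℓ]
    simp only [map_mul, map_pow, map_sub, map_neg, map_one, hgeom, MvPolynomial.aeval_X,
      Matrix.cons_val_zero, Matrix.cons_val_one]
    rw [zero_sub, ← mul_assoc, mul_comm]
    congr 1
    obtain ⟨m, rfl⟩ := Nat.exists_eq_add_of_le hr
    rw [Nat.add_sub_cancel_left, pow_add, mul_assoc, ← mul_pow, htu, one_pow, mul_one]
    rfl
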